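/- Conventions. Let $\mathbb{K}=\mathbb{R}$ or $\mathbb{C}$ and let $E,F$ be Banach spaces over $\mathbb{K}$, with $E'$ the dual of $E$. For a positive integer $n$, $\mathcal{P}(^{n}E;F)$ denotes the space of continuous $n$-homogeneous polynomials from $E$ to $F$, that is, mappings of the form $x\mapsto A(x,\dots,x)$ with $A\colon E^n\to F$ continuous and $n$-linear; $\mathcal{P}(^{n}E):=\mathcal{P}(^{n}E;\mathbb{K})$. A sequence $(x_j)_{j\ge 1}$ in $E$ is unconditionally $1$-summable if $\sum_j|\varphi(x_j)|<\infty$ for every $\varphi\in E'$ and $$\lim_{k\to\infty}\ \sup\Big\{\sum_{j\ge k}|\varphi(x_j)| : \varphi\in E',\ \|\varphi\|\le 1\Big\}=0 .$$ For a mapping $f\colon E\to F$, the $1$-summing set $S_1(f)$ is the set of all $a\in E$ such that $\sum_{j}\|f(a+x_j)-f(a)\|<\infty$ for every unconditionally $1$-summable sequence $(x_j)$ in $E$. A set $A\subseteq E$ is spaceable if $A\cup\{0\}$ contains a closed infinite-dimensional linear subspace of $E$. For $P\colon E\to\mathbb{K}$ and $g\colon E\to F$, $P\cdot g$ is the mapping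 $x\mapsto P(x)g(x)$. Corollary. (a) (Complex case) Let $E$ and $F$ be complex Banach spaces with $E$ infinite-dimensional, let $n\ge 1$, let $P\in\mathcal{P}(^{n}E)$ and let $g\colon E\to F$ be continuous. Then $S_1(P\cdot g)$ is spaceable. (b) (Real case) Let $E$ and $F$ be real Banach spaces with $E$ infinite-dimensional. At least one of the following holds: (b1) there exists $P\in\mathcal{P}(^{3}E;E)$ such that $S_1(P)=\{0\}$; (b2) for every $P\in\mathcal{P}(^{2}E)$ and every continuous mapping $g\colon E\to F$, the set $S_1(P\cdot g)$ is spaceable. -/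

import Mathlib

open Filter Topology
open scoped ENNReal NNReal

namespace SummingSets

section

variable (𝕜 : Type*) [RCLike 𝕜]
variable {E : Type*} [NormedAddCommGroup E] [NormedSpace 𝕜 E]
variable {F : Type*} [NormedAddCommGroup F] [NormedSpace 𝕜 F]

/-- `P` is a continuous `n`-homogeneous polynomial from `E` to `F`: it is the restriction to the
diagonal of a continuous `n`-linear mapping. (By polarization this is the same as asking for a
symmetric such mapping, or for `P` itself to be continuous.) -/
def IsHomogeneousPolynomial (n : ℕ) (P : E → F) : Prop :=
  ∃ A : ContinuousMultilinearMap 𝕜 (fun _ : Fin n => E) F, ∀ x : E, P x = A (fun _ => x)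

/-- The weak `q`-norm `sup {(∑ⱼ |φ(xⱼ)|^q)^(1/q) : φ ∈ E', ‖φ‖ ≤ 1}` of a sequence, with values in
`[0, ∞]`. -/
noncomputable def weakNorm (q : ℝ≥0) (x : ℕ → E) : ℝ≥0∞ :=
  ⨆ (φ : StrongDual 𝕜 E) (_ : ‖φ‖ ≤ 1), (∑' j, ‖φ (x j)‖ₑ ^ (q : ℝ)) ^ (1 / (q : ℝ))

/-- The space `ℓ_q^w(E)`: `(φ(xⱼ))ⱼ ∈ ℓ_q` for every `φ ∈ E'`. -/
def WeaklySummable (q : ℝ≥0) (x : ℕ → E) : Prop :=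
  ∀ φ : StrongDual 𝕜 E, Memℓp (fun j => φ (x j)) (q : ℝ≥0∞)

/-- The space `ℓ_q^u(E)` of unconditionally `q`-summable sequences: those in `ℓ_q^w(E)` whose tails
tend to zero in the weak `q`-norm. -/
def UnconditionallySummable (q : ℝ≥0) (x : ℕ → E) : Prop :=
  WeaklySummable 𝕜 q x ∧ Tendsto (fun k : ℕ => weakNorm 𝕜 q (fun j => x (k + j))) atTop (𝓝 0)

/-- `f` is `(p; q)`-summing at `a`: `(f(a + xⱼ) - f(a))ⱼ ∈ ℓ_p(F)` whenever `(xⱼ)ⱼ ∈ ℓ_q^u(E)`. -/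
def IsSummingAt (p q : ℝ≥0) (f : E → F) (a : E) : Prop :=
  ∀ x : ℕ → E, UnconditionallySummable 𝕜 q x →
    Memℓp (fun j => f (a + x j) - f a) (p : ℝ≥0∞)

/-- The `(p; q)`-summing set `S_{p;q}(f)`. -/
def summingSet (p q : ℝ≥0) (f : E → F) : Set E :=
  {a : E | IsSummingAt 𝕜 p q f a}

/-- The `1`-summing set `S₁(f) = S_{1;1}(f)`. -/
def summingSetOne (f : E → F) : Set E :=
  summingSet 𝕜 1 1 f

/-- `A` is spaceable: `A ∪ {0}` contains a closed infinite-dimensional linear subspace. -/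
def Spaceable (A : Set E) : Prop :=
  ∃ G : Submodule 𝕜 E, IsClosed (G : Set E) ∧ ¬ FiniteDimensional 𝕜 G ∧ (G : Set E) ⊆ A ∪ {0}

end

end SummingSets

/-! Scalar polynomials are 1-summing at every point, and `g (a + x j)` stays bounded because `x j →
0`. Hence `P · g` is summing at each zero of `P`. The zero set is closed, so spaceability follows
once `P` vanishes on an infinite-dimensional subspace (`spaceable_summingSetOne_of_vanishing`).

Over `ℂ` such a subspace always exists (`diagonalVanishing_of_isAlgClosed`).

Over `ℝ` the alternative is whether `E` carries a continuous positive definite quadratic form `Q`.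
If it does, `x ↦ Q x • x` is summing only at `0`: at `a ≠ 0` summable increments would give `∑ Q a *
‖x j‖ < ∞` for every unconditionally summable sequence, against Dvoretzky–Rogers. If it does not,
every quadratic form has an infinite-dimensional isotropic subspace: a finite-dimensional maximal
one would make the form definite on a subspace of finite codimension, and a Euclidean correction
would produce `Q`. -/

namespace SummingSets

/-! ### Summability of the increments of scalar polynomials -/

section Summability

variable {𝕜 : Type*} [RCLike 𝕜]
variable {E : Type*} [NormedAddCommGroup E] [NormedSpace 𝕜 E]
variable {F : Type*} [NormedAddCommGroup F] [NormedSpace 𝕜 F]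

theorem memℓp_one_iff_summable {f : ℕ → F} :
    Memℓp f ((1 : ℝ≥0) : ℝ≥0∞) ↔ Summable fun j => ‖f j‖ := by
  rw [memℓp_gen_iff (by simp)]
  simp

theorem weakNorm_one (x : ℕ → E) :
    weakNorm 𝕜 1 x = ⨆ (φ : StrongDual 𝕜 E) (_ : ‖φ‖ ≤ 1), ∑' j, ‖φ (x j)‖ₑ := by
  simp [weakNorm]

theorem tsum_enorm_le_weakNorm_one (x : ℕ → E) {φ : StrongDual 𝕜 E} (hφ : ‖φ‖ ≤ 1) :
    ∑' j, ‖φ (x j)‖ₑ ≤ weakNorm 𝕜 1 x := by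
  rw [weakNorm_one]
  exact le_iSup₂ (f := fun (φ : StrongDual 𝕜 E) (_ : ‖φ‖ ≤ 1) => ∑' j, ‖φ (x j)‖ₑ) φ hφ

theorem enorm_sum_smul_le_weakNorm_one (x : ℕ → E) (S : Finset ℕ) {c : ℕ → 𝕜}
    (hc : ∀ j, ‖c j‖ ≤ 1) : ‖∑ j ∈ S, c j • x j‖ₑ ≤ weakNorm 𝕜 1 x := by
  obtain ⟨φ, hφ, h⟩ := exists_dual_vector'' 𝕜 (∑ j ∈ S, c j • x j)
  have h1 : ‖∑ j ∈ S, c j • x j‖ₑ = ‖φ (∑ j ∈ S, c j • x j)‖ₑ := by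
    rw [h, ← enorm_norm]
    simp [enorm, nnnorm]
  rw [h1, map_sum]
  calc ‖∑ j ∈ S, φ (c j • x j)‖ₑ ≤ ∑ j ∈ S, ‖φ (c j • x j)‖ₑ := enorm_sum_le _ _
    _ ≤ ∑ j ∈ S, ‖φ (x j)‖ₑ := by
        refine Finset.sum_le_sum fun j _ => ?_
        rw [map_smul, smul_eq_mul, enorm_mul]
        refine mul_le_of_le_one_left' ?_
        rw [← enorm_norm, ← ofReal_norm, ENNReal.ofReal_le_one]
        simpa using hc j
    _ ≤ ∑' j, ‖φ (x j)‖ₑ := ENNReal.sum_le_tsum _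
    _ ≤ _ := tsum_enorm_le_weakNorm_one x hφ

theorem UnconditionallySummable.tendsto_zero {x : ℕ → E} (hx : UnconditionallySummable 𝕜 1 x) :
    Tendsto x atTop (𝓝 0) := by
  rw [tendsto_zero_iff_enorm_tendsto_zero]
  refine tendsto_of_tendsto_of_tendsto_of_le_of_le tendsto_const_nhds hx.2
    (fun _ => zero_le) fun k => ?_
  simpa using enorm_sum_smul_le_weakNorm_one (𝕜 := 𝕜) (fun j => x (k + j)) {0}
    (c := fun _ => 1) (by simp)

theorem UnconditionallySummable.exists_tail_bound {x : ℕ → E}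
    (hx : UnconditionallySummable 𝕜 1 x) :
    ∃ N : ℕ, ∃ C : ℝ, 0 ≤ C ∧ ∀ (S : Finset ℕ) (c : ℕ → 𝕜), (∀ j, ‖c j‖ ≤ 1) →
      ‖∑ j ∈ S, c j • x (N + j)‖ ≤ C := by
  obtain ⟨N, hN⟩ := (hx.2.eventually (gt_mem_nhds (zero_lt_one))).exists
  refine ⟨N, 1, zero_le_one, fun S c hc => ?_⟩
  have := (enorm_sum_smul_le_weakNorm_one (𝕜 := 𝕜) (fun j => x (N + j)) S hc).trans hN.le
  rwa [← ofReal_norm, ENNReal.ofReal_le_one] at this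

/-- Averaging over random signs kills the off-diagonal terms, so some choice of signs does at least
as well as the diagonal. Indices are added one at a time: a sign `s` at the new index gives `v + s •
w`, and `v` is the midpoint of `v ± w`. -/
theorem exists_sign_norm_trace_le (a : ℕ → ℕ → F) (S : Finset ℕ) :
    ∀ b : F, ∃ ε : ℕ → 𝕜, (∀ j, ‖ε j‖ ≤ 1) ∧
      ‖b + ∑ j ∈ S, a j j‖ ≤ ‖b + ∑ i ∈ S, ∑ j ∈ S, (ε i * ε j) • a i j‖ := by
  induction S using Finset.induction_on with
  | empty => exact fun b => ⟨fun _ => 1, by simp, by simp⟩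
  | insert k S hk ih =>
    intro b
    obtain ⟨ε, hε, h⟩ := ih (b + a k k)
    set w : F := ∑ i ∈ S, ε i • (a i k + a k i) with hw
    set v : F := b + a k k + ∑ i ∈ S, ∑ j ∈ S, (ε i * ε j) • a i j with hv
    have key : ∀ s : 𝕜, s * s = 1 →
        b + ∑ i ∈ insert k S, ∑ j ∈ insert k S,
          (Function.update ε k s i * Function.update ε k s j) • a i j = v + s • w := by
      intro s hs
      have hne : ∀ i ∈ S, Function.update ε k s i = ε i := fun i hi =>
        Function.update_of_ne (fun h => hk (by rwa [← h])) _ _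
      rw [Finset.sum_insert hk, Finset.sum_insert hk]
      have e1 : ∑ i ∈ S, ∑ j ∈ insert k S,
          (Function.update ε k s i * Function.update ε k s j) • a i j =
          ∑ i ∈ S, (s • ε i • a i k + ∑ j ∈ S, (ε i * ε j) • a i j) := by
        refine Finset.sum_congr rfl fun i hi => ?_
        rw [Finset.sum_insert hk, hne i hi, Function.update_self, mul_comm, mul_smul]
        congr 1
        exact Finset.sum_congr rfl fun j hj => by rw [hne j hj]
      have e2 : ∑ j ∈ S, (Function.update ε k s k * Function.update ε k s j) • a k j =
          ∑ j ∈ S, s • ε j • a k j :=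
        Finset.sum_congr rfl fun j hj => by rw [hne j hj, Function.update_self, mul_smul]
      rw [e1, e2, Function.update_self, hs, one_smul, hv, hw, Finset.sum_add_distrib,
        Finset.smul_sum]
      simp only [smul_add, Finset.sum_add_distrib]
      abel
    have h2 : ‖v‖ ≤ ‖v + w‖ ∨ ‖v‖ ≤ ‖v - w‖ := by
      by_contra! hcon
      have h3 : ‖(2 : 𝕜) • v‖ ≤ ‖v + w‖ + ‖v - w‖ := by
        have : (2 : 𝕜) • v = (v + w) + (v - w) := by rw [two_smul]; abel
        rw [this]
        exact norm_add_le _ _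
      rw [norm_smul, RCLike.norm_two] at h3
      linarith [hcon.1, hcon.2]
    have h4 : ‖b + ∑ j ∈ insert k S, a j j‖ ≤ ‖v‖ := by
      rw [Finset.sum_insert hk, ← add_assoc]
      exact h
    have hup : ∀ s : 𝕜, ‖s‖ ≤ 1 → ∀ j, ‖Function.update ε k s j‖ ≤ 1 := by
      intro s hs j
      by_cases hj : j = k
      · subst hj; simpa using hs
      · simpa [Function.update_of_ne hj] using hε j
    rcases h2 with h2 | h2
    · refine ⟨Function.update ε k 1, hup 1 (by simp), ?_⟩
      rw [key 1 (by simp), one_smul]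
      exact h4.trans h2
    · refine ⟨Function.update ε k (-1), hup (-1) (by simp), ?_⟩
      rw [key (-1) (by simp), neg_one_smul, ← sub_eq_add_neg]
      exact h4.trans h2

/-- Induction on the degree, by the product rule in the first slot. `K` must not depend on `A`,
since the induction hypothesis is applied to forms that vary with `S` and the signs. -/
theorem exists_bound_sum_increments (a : E) {x : ℕ → E} {C : ℝ} (hC0 : 0 ≤ C)
    (hC : ∀ (S : Finset ℕ) (c : ℕ → 𝕜), (∀ j, ‖c j‖ ≤ 1) → ‖∑ j ∈ S, c j • x j‖ ≤ C) (n : ℕ) :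
    ∃ K : ℝ, 0 ≤ K ∧ ∀ (A : ContinuousMultilinearMap 𝕜 (fun _ : Fin n => E) F) (S : Finset ℕ)
      (c : ℕ → 𝕜), (∀ j, ‖c j‖ ≤ 1) →
      ‖∑ j ∈ S, c j • (A (fun _ => a + x j) - A (fun _ => a))‖ ≤ ‖A‖ * K := by
  induction n with
  | zero =>
    refine ⟨0, le_rfl, fun A S c _ => ?_⟩
    have h (j) : (fun _ : Fin 0 => a + x j) = fun _ => a := Subsingleton.elim _ _
    simp [h]
  | succ n ih =>
    obtain ⟨K, hK0, hK⟩ := ih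
    refine ⟨‖a‖ * K + C * K + C * ‖a‖ ^ n, by positivity, fun A S c hc => ?_⟩
    have hcons : ∀ y : E, A (fun _ => y) = A.curryLeft y (fun _ => y) := by
      intro y
      rw [ContinuousMultilinearMap.curryLeft_apply]
      congr 1
      funext i
      refine Fin.cases ?_ (fun _ => ?_) i <;> simp
    set L := A.curryLeft with hL
    have hLn (y : E) : ‖L y‖ ≤ ‖A‖ * ‖y‖ := by
      rw [← ContinuousMultilinearMap.curryLeft_norm A]
      exact L.le_opNorm y
    have split : ∑ j ∈ S, c j • (A (fun _ => a + x j) - A (fun _ => a)) =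
        ∑ j ∈ S, c j • (L a (fun _ => a + x j) - L a (fun _ => a)) +
        (∑ j ∈ S, c j • (L (x j) (fun _ => a + x j) - L (x j) (fun _ => a)) +
          L (∑ j ∈ S, c j • x j) (fun _ => a)) := by
      rw [map_sum, sum_apply, ← Finset.sum_add_distrib,
        ← Finset.sum_add_distrib]
      refine Finset.sum_congr rfl fun j _ => ?_
      rw [hcons, hcons, map_add, map_smul, add_apply,
        smul_apply, ← smul_add, ← smul_add]
      congr 1
      abel
    have b1 : ‖∑ j ∈ S, c j • (L a (fun _ => a + x j) - L a (fun _ => a))‖ ≤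
        ‖A‖ * (‖a‖ * K) := by
      refine (hK (L a) S c hc).trans ?_
      rw [← mul_assoc]
      exact mul_le_mul_of_nonneg_right (hLn a) hK0
    have b2 : ‖L (∑ j ∈ S, c j • x j) (fun _ => a)‖ ≤ ‖A‖ * (C * ‖a‖ ^ n) := by
      refine ((L _).le_opNorm _).trans ?_
      rw [Finset.prod_const, Finset.card_univ, Fintype.card_fin, ← mul_assoc]
      refine mul_le_mul_of_nonneg_right ((hLn _).trans ?_) (by positivity)
      exact mul_le_mul_of_nonneg_left (hC S c hc) (norm_nonneg _)
    have b3 : ‖∑ j ∈ S, c j • (L (x j) (fun _ => a + x j) - L (x j) (fun _ => a))‖ ≤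
        ‖A‖ * (C * K) := by
      -- Here `x j` enters in two places. The signs decouple them: `L (x j)` is replaced by the
      -- single form `L (∑ i, ε i • x i)`, of norm at most `‖A‖ * C`.
      obtain ⟨ε, hε, h⟩ := exists_sign_norm_trace_le (𝕜 := 𝕜)
        (fun i j => c j • (L (x i) (fun _ => a + x j) - L (x i) (fun _ => a))) S 0
      rw [zero_add, zero_add] at h
      have e : ∑ i ∈ S, ∑ j ∈ S, (ε i * ε j) • c j •
            (L (x i) (fun _ => a + x j) - L (x i) (fun _ => a)) =
          ∑ j ∈ S, (ε j * c j) • (L (∑ i ∈ S, ε i • x i) (fun _ => a + x j) -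
            L (∑ i ∈ S, ε i • x i) (fun _ => a)) := by
        rw [Finset.sum_comm]
        refine Finset.sum_congr rfl fun j _ => ?_
        rw [map_sum, sum_apply, sum_apply,
          ← Finset.sum_sub_distrib, Finset.smul_sum]
        refine Finset.sum_congr rfl fun i _ => ?_
        rw [map_smul, smul_apply, smul_apply,
          ← smul_sub, smul_smul, smul_smul]
        congr 1
        ring
      refine h.trans (e ▸ (hK _ S _ fun j => ?_).trans ?_)
      · rw [norm_mul]
        exact mul_le_one₀ (hε j) (norm_nonneg _) (hc j)
      · rw [← mul_assoc]
        refine mul_le_mul_of_nonneg_right ((hLn _).trans ?_) hK0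
        exact mul_le_mul_of_nonneg_left (hC S ε hε) (norm_nonneg _)
    rw [split]
    refine (norm_add_le _ _).trans ((add_le_add b1 ((norm_add_le _ _).trans
      (add_le_add b3 b2))).trans (le_of_eq ?_))
    ring

/-- Scalar-valued polynomials are `(1; 1)`-summing at every point. -/
theorem IsHomogeneousPolynomial.summable_increments {n : ℕ} {P : E → 𝕜}
    (hP : IsHomogeneousPolynomial 𝕜 n P) (a : E) {x : ℕ → E}
    (hx : UnconditionallySummable 𝕜 1 x) : Summable fun j => ‖P (a + x j) - P a‖ := by
  obtain ⟨A, hA⟩ := hP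
  obtain ⟨N, C, hC0, hC⟩ := hx.exists_tail_bound
  obtain ⟨K, -, hK⟩ := exists_bound_sum_increments (F := 𝕜) a hC0 hC n
  rw [← summable_nat_add_iff N]
  refine summable_of_sum_le (c := ‖A‖ * K) (fun _ => norm_nonneg _) fun S => ?_
  -- Scalar values matter here: weights can align all increments, so the bound on weighted sums
  -- bounds the sum of moduli.
  have hex : ∀ z : 𝕜, ∃ c : 𝕜, ‖c‖ ≤ 1 ∧ c * z = (‖z‖ : 𝕜) := by
    intro z
    by_cases hz : z = 0
    · exact ⟨0, by simp, by simp [hz]⟩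
    · have hz' : (‖z‖ : 𝕜) ≠ 0 := by simpa using hz
      refine ⟨(‖z‖ : 𝕜) * z⁻¹, ?_, ?_⟩
      · rw [norm_mul, norm_inv, RCLike.norm_ofReal, abs_norm]
        exact mul_inv_le_one
      · rw [mul_assoc, inv_mul_cancel₀ hz, mul_one]
  choose θ hθ1 hθ using hex
  have h := hK A S (fun j => θ (P (a + x (N + j)) - P a)) fun j => hθ1 _
  simp only [← hA, smul_eq_mul, hθ] at h
  rw [← RCLike.ofReal_sum, RCLike.norm_ofReal, abs_of_nonneg (by positivity)] at h
  simpa only [add_comm] using h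

theorem mem_summingSetOne_of_eq_zero {n : ℕ} {P : E → 𝕜} (hP : IsHomogeneousPolynomial 𝕜 n P)
    {g : E → F} (hg : Continuous g) {a : E} (ha : P a = 0) :
    a ∈ summingSetOne 𝕜 fun x => P x • g x := by
  intro x hx
  rw [memℓp_one_iff_summable]
  have hs := hP.summable_increments a hx
  have hlim : Tendsto (fun j => g (a + x j)) atTop (𝓝 (g a)) := by
    have : Tendsto (fun j => a + x j) atTop (𝓝 (a + 0)) := hx.tendsto_zero.const_add a
    rw [add_zero] at this
    exact (hg.tendsto a).comp this
  obtain ⟨M, hM⟩ := hlim.norm.bddAbove_range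
  refine Summable.of_nonneg_of_le (fun _ => norm_nonneg _) (fun j => ?_) (hs.mul_right M)
  simp only [ha, zero_smul, sub_zero, norm_smul]
  exact mul_le_mul_of_nonneg_left (hM ⟨j, rfl⟩) (norm_nonneg _)

theorem IsHomogeneousPolynomial.continuous {n : ℕ} {P : E → F}
    (hP : IsHomogeneousPolynomial 𝕜 n P) : Continuous P := by
  obtain ⟨A, hA⟩ := hP
  rw [funext hA]
  exact A.cont.comp (continuous_pi fun _ => continuous_id)

theorem spaceable_summingSetOne_of_vanishing {n : ℕ} {P : E → 𝕜}
    (hP : IsHomogeneousPolynomial 𝕜 n P) {g : E → F} (hg : Continuous g) {W : Submodule 𝕜 E}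
    (hW : ¬ FiniteDimensional 𝕜 W) (hPW : ∀ w ∈ W, P w = 0) :
    Spaceable 𝕜 (summingSetOne 𝕜 fun x => P x • g x) := by
  refine ⟨W.topologicalClosure, W.isClosed_topologicalClosure, fun h => hW ?_, fun a ha => ?_⟩
  · exact Submodule.finiteDimensional_of_le W.le_topologicalClosure
  · refine Or.inl (mem_summingSetOne_of_eq_zero hP hg ?_)
    have hcl : closure (W : Set E) ⊆ P ⁻¹' {0} :=
      closure_minimal hPW (isClosed_singleton.preimage hP.continuous)
    exact hcl ha

end Summability

end SummingSets

namespace SummingSets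

/-! ### Infinite-dimensional zero subspaces over algebraically closed fields -/

section Zeros

variable {K E : Type*} [Field K] [AddCommGroup E] [Module K E]

theorem not_finiteDimensional_inf_ker {W : Submodule K E} (hW : ¬ FiniteDimensional K W)
    (f : E →ₗ[K] K) : ¬ FiniteDimensional K (W ⊓ LinearMap.ker f : Submodule K E) := by
  intro h
  apply hW
  let N := LinearMap.ker (f.domRestrict W)
  have hN : FiniteDimensional K N := by
    let i : N →ₗ[K] (W ⊓ LinearMap.ker f : Submodule K E) :=
      (W.subtype.comp N.subtype).codRestrict _ fun z => ⟨z.1.2, z.2⟩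
    refine FiniteDimensional.of_injective i fun a b hab => ?_
    exact Subtype.ext (Subtype.ext (Subtype.ext_iff.1 hab :))
  have hQ : FiniteDimensional K (W ⧸ N) :=
    LinearEquiv.finiteDimensional (f.domRestrict W).quotKerEquivRange.symm
  exact Module.Finite.of_submodule_quotient N

theorem exists_infinite_submodule_notMem {W : Submodule K E} (hW : ¬ FiniteDimensional K W)
    {x : E} (hx : x ≠ 0) : ∃ W' ≤ W, ¬ FiniteDimensional K W' ∧ x ∉ W' := by
  obtain ⟨f, hf⟩ := Classical.not_forall.1 (mt (Module.forall_dual_apply_eq_zero_iff K x).1 hx)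
  exact ⟨_, inf_le_left, not_finiteDimensional_inf_ker hW f, fun h => hf h.2⟩

theorem exists_mem_ne_zero_of_not_finiteDimensional {W : Submodule K E}
    (hW : ¬ FiniteDimensional K W) : ∃ x ∈ W, x ≠ 0 := by
  refine Submodule.exists_mem_ne_zero_of_ne_bot fun h => hW ?_
  subst h
  infer_instance

/-- Every infinite-dimensional subspace contains an infinite-dimensional subspace on which the
diagonal of a given `n`-linear form vanishes. -/
def DiagonalVanishing (K E : Type*) [Field K] [AddCommGroup E] [Module K E] (n : ℕ) : Prop :=
  ∀ (A : MultilinearMap K (fun _ : Fin n => E) K) (W : Submodule K E), ¬ FiniteDimensional K W →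
    ∃ W' ≤ W, ¬ FiniteDimensional K W' ∧ ∀ w ∈ W', A (fun _ => w) = 0

/-- Freezing `x` outside `s` leaves a form of degree `s.card`, strictly between `0` and `n`, so
lower degrees apply; the subspace shrinks once for each `s`. -/
theorem exists_mixed_vanishing {n : ℕ} (hV : ∀ k, 1 ≤ k → k < n → DiagonalVanishing K E k)
    (A : MultilinearMap K (fun _ : Fin n => E) K) {W : Submodule K E}
    (hW : ¬ FiniteDimensional K W) (x : E) (T : Finset (Finset (Fin n)))
    (hT : ∀ s ∈ T, s.Nonempty ∧ s ≠ Finset.univ) :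
    ∃ W' ≤ W, ¬ FiniteDimensional K W' ∧
      ∀ s ∈ T, ∀ w ∈ W', A (s.piecewise (fun _ => w) (fun _ => x)) = 0 := by
  induction T using Finset.induction_on with
  | empty => exact ⟨W, le_rfl, hW, by simp⟩
  | insert s T _ ih =>
    obtain ⟨W₁, h₁, hi₁, hv₁⟩ := ih fun t ht => hT t (Finset.mem_insert_of_mem ht)
    obtain ⟨hs, hs'⟩ := hT s (Finset.mem_insert_self _ _)
    have hlt : s.card < n := by
      simpa using Finset.card_lt_univ_of_notMem
        (Classical.not_forall.1 fun h => hs' (Finset.eq_univ_iff_forall.2 h)).choose_spec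
    obtain ⟨W₂, h₂, hi₂, hv₂⟩ := hV s.card hs.card_pos hlt (A.restr s rfl x) W₁ hi₁
    refine ⟨W₂, h₂.trans h₁, hi₂, fun t ht w hw => ?_⟩
    rcases Finset.mem_insert.1 ht with rfl | ht
    · rw [← hv₂ w hw, MultilinearMap.restr]
      simp only [MultilinearMap.coe_mk, dite_eq_ite]
      rfl
    · exact hv₁ t ht w (h₂ hw)

theorem exists_submodule_diagonal_add {n : ℕ} (hn : 1 ≤ n)
    (hV : ∀ k, 1 ≤ k → k < n → DiagonalVanishing K E k)
    (A : MultilinearMap K (fun _ : Fin n => E) K) {W : Submodule K E}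
    (hW : ¬ FiniteDimensional K W) {x : E} (hx : x ≠ 0) :
    ∃ W' ≤ W, ¬ FiniteDimensional K W' ∧ x ∉ W' ∧ ∀ (c : K), ∀ w ∈ W',
      A (fun _ => c • x + w) = c ^ n * A (fun _ => x) + A (fun _ => w) := by
  obtain ⟨W₁, h₁, hi₁, hx₁⟩ := exists_infinite_submodule_notMem hW hx
  obtain ⟨W₂, h₂, hi₂, hv₂⟩ := exists_mixed_vanishing hV A hi₁ x
    ((Finset.univ.erase Finset.univ).erase ∅) (by
      intro s hs
      simp only [Finset.mem_erase, Finset.mem_univ, and_true] at hs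
      exact ⟨Finset.nonempty_iff_ne_empty.2 hs.1, hs.2⟩)
  have hne : (∅ : Finset (Fin n)) ≠ Finset.univ := by
    have : Nonempty (Fin n) := ⟨⟨0, hn⟩⟩
    exact Finset.univ_nonempty.ne_empty.symm
  have hone : ∀ w ∈ W₂, A (fun _ => x + w) = A (fun _ => x) + A (fun _ => w) := by
    intro w hw
    have e : (fun _ : Fin n => x + w) = (fun _ => w) + fun _ => x := by
      funext i
      exact add_comm _ _
    rw [e, A.map_add_univ, ← Finset.add_sum_erase _ _ (Finset.mem_univ Finset.univ),
      ← Finset.add_sum_erase _ _ (Finset.mem_erase.2 ⟨hne, Finset.mem_univ ∅⟩),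
      Finset.sum_eq_zero fun s hs => hv₂ s hs w hw]
    simp [add_comm]
  have hsmul : ∀ (c : K) (z : E), A (fun _ => c • z) = c ^ n * A (fun _ => z) := by
    intro c z
    simpa using A.map_smul_univ (fun _ => c) (fun _ => z)
  refine ⟨W₂, h₂.trans h₁, hi₂, fun h => hx₁ (h₂ h), fun c w hw => ?_⟩
  by_cases hc : c = 0
  · simp [hc, zero_pow (Nat.one_le_iff_ne_zero.1 hn)]
  · have e : c • x + w = c • (x + c⁻¹ • w) := by
      rw [smul_add, smul_inv_smul₀ hc]
    rw [e, hsmul, hone _ (W₂.smul_mem _ hw), mul_add, ← hsmul c (c⁻¹ • w), smul_inv_smul₀ hc]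

/-- Two successive splittings make the form additive along `x₁`, `x₂` and the remaining subspace. An
`n`-th root then gives a nonzero combination of `x₁`, `x₂` on which it vanishes. -/
theorem exists_vector_diagonal_invariant [IsAlgClosed K] {n : ℕ} (hn : 1 ≤ n)
    (hV : ∀ k, 1 ≤ k → k < n → DiagonalVanishing K E k)
    (A : MultilinearMap K (fun _ : Fin n => E) K) {W : Submodule K E}
    (hW : ¬ FiniteDimensional K W) :
    ∃ y ∈ W, ∃ W' ≤ W, ¬ FiniteDimensional K W' ∧ y ∉ W' ∧ ∀ (c : K), ∀ w ∈ W',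
      A (fun _ => c • y + w) = A (fun _ => w) := by
  obtain ⟨x₁, hxW₁, hx₁⟩ := exists_mem_ne_zero_of_not_finiteDimensional hW
  obtain ⟨W₁, h₁, hi₁, hm₁, hv₁⟩ := exists_submodule_diagonal_add hn hV A hW hx₁
  obtain ⟨x₂, hxW₂, hx₂⟩ := exists_mem_ne_zero_of_not_finiteDimensional hi₁
  obtain ⟨W₂, h₂, hi₂, hm₂, hv₂⟩ := exists_submodule_diagonal_add hn hV A hi₁ hx₂
  obtain ⟨α, β, hαβ, h0⟩ : ∃ α β : K, (α = 0 → β ≠ 0) ∧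
      α ^ n * A (fun _ => x₁) + β ^ n * A (fun _ => x₂) = 0 := by
    by_cases hA : A (fun _ => x₁) = 0
    · exact ⟨1, 0, by simp, by simp [hA, zero_pow (Nat.one_le_iff_ne_zero.1 hn)]⟩
    · obtain ⟨z, hz⟩ := IsAlgClosed.exists_pow_nat_eq (-A (fun _ => x₂) / A (fun _ => x₁)) hn
      exact ⟨z, 1, by simp, by rw [hz]; field_simp; ring⟩
  refine ⟨α • x₁ + β • x₂, W.add_mem (W.smul_mem _ hxW₁) (W.smul_mem _ (h₁ hxW₂)), W₂,
    h₂.trans h₁, hi₂, fun hmem => ?_, fun c w hw => ?_⟩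
  · by_cases hα : α = 0
    · rw [hα, zero_smul, zero_add, W₂.smul_mem_iff (hαβ hα)] at hmem
      exact hm₂ hmem
    · have := W₁.sub_mem (h₂ hmem) (W₁.smul_mem β hxW₂)
      rw [add_sub_cancel_right, W₁.smul_mem_iff hα] at this
      exact hm₁ this
  · have e : c • (α • x₁ + β • x₂) + w = (c * α) • x₁ + ((c * β) • x₂ + w) := by
      rw [smul_add, smul_smul, smul_smul, add_assoc]
    rw [e, hv₁ _ _ (W₁.add_mem (W₁.smul_mem _ hxW₂) (h₂ hw)), hv₂ _ _ hw]
    linear_combination c ^ n * h0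

theorem exists_infinite_vanishing_of_step (p : E → K) (hp0 : p 0 = 0)
    (hstep : ∀ W : Submodule K E, ¬ FiniteDimensional K W → ∃ y ∈ W, ∃ W' ≤ W,
      ¬ FiniteDimensional K W' ∧ y ∉ W' ∧ ∀ (c : K), ∀ w ∈ W', p (c • y + w) = p w)
    {W : Submodule K E} (hW : ¬ FiniteDimensional K W) :
    ∃ G ≤ W, ¬ FiniteDimensional K G ∧ ∀ w ∈ G, p w = 0 := by
  choose! y hy next hle hinf hny hinv using hstep
  let V : ℕ → Submodule K E := fun k => next^[k] W
  have hVs (k) : V (k + 1) = next (V k) := Function.iterate_succ_apply' _ _ _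
  -- `V k` shrinks while `U k`, spanned by the vectors already chosen, grows. Adding a vector of `U
  -- k` does not change `p` on `V k`; taking `0` in `V k` gives `p = 0` on `U k`.
  have hVi : ∀ k, ¬ FiniteDimensional K (V k) := by
    intro k
    induction k with
    | zero => exact hW
    | succ k ih => rw [hVs]; exact hinf _ ih
  have hVle : ∀ k, V k ≤ W := by
    intro k
    induction k with
    | zero => exact le_rfl
    | succ k ih => rw [hVs]; exact (hle _ (hVi k)).trans ih
  obtain ⟨U, hU0, hUs⟩ : ∃ U : ℕ → Submodule K E, U 0 = ⊥ ∧ ∀ k, U (k + 1) = U k ⊔ K ∙ y (V k) :=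
    ⟨fun k => Nat.rec (motive := fun _ => Submodule K E) ⊥ (fun i X => X ⊔ K ∙ y (V i)) k,
      rfl, fun _ => rfl⟩
  have hmono : Monotone U := monotone_nat_of_le_succ fun k => by rw [hUs]; exact le_sup_left
  have hUW : ∀ k, U k ≤ W := by
    intro k
    induction k with
    | zero => exact hU0 ▸ bot_le
    | succ k ih =>
      rw [hUs, sup_le_iff, Submodule.span_singleton_le_iff_mem]
      exact ⟨ih, hVle k (hy _ (hVi k))⟩
  have hUp : ∀ k, ∀ v ∈ U k, ∀ w ∈ V k, p (v + w) = p w := by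
    intro k
    induction k with
    | zero =>
      intro v hv w _
      rw [(Submodule.mem_bot K).1 (by rwa [hU0] at hv : v ∈ (⊥ : Submodule K E)), zero_add]
    | succ k ih =>
      intro v hv w hw
      rw [hVs] at hw
      obtain ⟨v', hv', z, hz, rfl⟩ := Submodule.mem_sup.1 (hUs k ▸ hv)
      obtain ⟨c, rfl⟩ := Submodule.mem_span_singleton.1 hz
      rw [add_assoc, ih v' hv' _ ((V k).add_mem ((V k).smul_mem _ (hy _ (hVi k)))
        (hle _ (hVi k) hw)), hinv _ (hVi k) _ _ hw]
  have hUV : ∀ k, ∀ v ∈ U k, v ∈ V k → v = 0 := by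
    intro k
    induction k with
    | zero => exact fun v hv _ => (Submodule.mem_bot K).1 (by rwa [hU0] at hv)
    | succ k ih =>
      intro v hv hvV
      rw [hVs] at hvV
      obtain ⟨v', hv', z, hz, rfl⟩ := Submodule.mem_sup.1 (hUs k ▸ hv)
      obtain ⟨c, rfl⟩ := Submodule.mem_span_singleton.1 hz
      have h0 : v' = 0 := by
        refine ih v' hv' ?_
        have := (V k).sub_mem (hle _ (hVi k) hvV) ((V k).smul_mem c (hy _ (hVi k)))
        rwa [add_sub_cancel_right] at this
      rw [h0, zero_add] at hvV ⊢
      by_cases hc : c = 0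
      · simp [hc]
      · exact absurd ((Submodule.smul_mem_iff _ hc).1 hvV) (hny _ (hVi k))
  have hlt (k) : U k < U (k + 1) := by
    refine lt_of_le_of_ne (hmono k.le_succ) fun h => ?_
    have hmem : y (V k) ∈ U k := by
      rw [h, hUs]
      exact Submodule.mem_sup_right (Submodule.mem_span_singleton_self _)
    have := hUV k _ hmem (hy _ (hVi k))
    exact hny _ (hVi k) (this ▸ Submodule.zero_mem _)
  refine ⟨⨆ k, U k, iSup_le hUW, fun hfin => ?_, fun w hw => ?_⟩
  · have hfd (k : ℕ) : FiniteDimensional K (U k) :=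
      Submodule.finiteDimensional_of_le (le_iSup U k)
    have hrank : ∀ k, k ≤ Module.finrank K (U k) := by
      intro k
      induction k with
      | zero => exact Nat.zero_le _
      | succ k ih => exact Nat.succ_le_of_lt (ih.trans_lt (Submodule.finrank_lt_finrank_of_lt (hlt k)))
    exact Nat.not_succ_le_self _ ((hrank (Module.finrank K (⨆ k, U k : Submodule K E) + 1)).trans
      (Submodule.finrank_mono (le_iSup U _)))
  · obtain ⟨k, hk⟩ := (Submodule.mem_iSup_of_directed U hmono.directed_le).1 hw
    have := hUp k w hk 0 (V k).zero_mem
    rwa [add_zero, hp0] at this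

/-- The Plichko–Zagorodnyuk theorem on zeros of homogeneous polynomials. -/
theorem diagonalVanishing_of_isAlgClosed [IsAlgClosed K] (n : ℕ) (hn : 1 ≤ n) :
    DiagonalVanishing K E n := by
  induction n using Nat.strong_induction_on with
  | _ n ih =>
    intro A W hW
    refine exists_infinite_vanishing_of_step (fun x => A fun _ => x) ?_
      (fun W' hW' => exists_vector_diagonal_invariant hn (fun k hk hkn => ih k hkn hk) A hW') hW
    exact A.map_coord_zero ⟨0, hn⟩ rfl

end Zeros

theorem IsHomogeneousPolynomial.exists_infinite_vanishing_complex {E : Type*}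
    [NormedAddCommGroup E] [NormedSpace ℂ E] (hE : ¬ FiniteDimensional ℂ E) {n : ℕ} (hn : 1 ≤ n)
    {P : E → ℂ} (hP : IsHomogeneousPolynomial ℂ n P) :
    ∃ W : Submodule ℂ E, ¬ FiniteDimensional ℂ W ∧ ∀ w ∈ W, P w = 0 := by
  obtain ⟨A, hA⟩ := hP
  obtain ⟨W, -, hW, h⟩ := diagonalVanishing_of_isAlgClosed n hn A.toMultilinearMap ⊤
    fun h => hE (Module.finite_def.2 (Module.Finite.iff_fg.1 h))
  exact ⟨W, hW, fun w hw => (hA w).trans (h w hw)⟩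

end SummingSets

namespace SummingSets

/-! ### Isotropic subspaces of real quadratic forms -/

section RealQuadratic

variable {E : Type*} [NormedAddCommGroup E] [NormedSpace ℝ E]

theorem apply_self_add_smul (B : E →L[ℝ] E →L[ℝ] ℝ) (x y : E) (t : ℝ) :
    B (x + t • y) (x + t • y) = B y y * (t * t) + (B x y + B y x) * t + B x x := by
  simp only [map_add, map_smul, add_apply, smul_apply, smul_eq_mul]
  ring

theorem exists_maximal_isotropic (B : E →L[ℝ] E →L[ℝ] ℝ) :
    ∃ W : Submodule ℝ E, Maximal (fun V : Submodule ℝ E => ∀ w ∈ V, B w w = 0) W := by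
  refine zorn_le₀ {V : Submodule ℝ E | ∀ w ∈ V, B w w = 0} fun c hc hchain => ?_
  rcases c.eq_empty_or_nonempty with rfl | hne
  · exact ⟨⊥, fun w hw => by simp [(Submodule.mem_bot ℝ).1 hw], by simp⟩
  · refine ⟨sSup c, fun w hw => ?_, fun z hz => le_sSup hz⟩
    obtain ⟨V, hV, hwV⟩ := (Submodule.mem_sSup_of_directed hne hchain.directedOn).1 hw
    exact hc hV w hwV

/-- If both signs occurred, the quadratic `t ↦ B (x + t • y) (x + t • y)` would have a real root,
forcing `x` to be a multiple of `y` and hence of the same sign. -/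
theorem exists_smul_pos_of_anisotropic (B : E →L[ℝ] E →L[ℝ] ℝ) (Y : Submodule ℝ E)
    (hY : ∀ y ∈ Y, B y y = 0 → y = 0) :
    ∃ σ : ℝ, ∀ y ∈ Y, y ≠ 0 → 0 < σ * B y y := by
  by_cases hpos : ∀ y ∈ Y, 0 ≤ B y y
  · refine ⟨1, fun y hy hy0 => ?_⟩
    rw [one_mul]
    exact lt_of_le_of_ne (hpos y hy) fun h => hy0 (hY y hy h.symm)
  · push Not at hpos
    obtain ⟨y, hy, hneg⟩ := hpos
    refine ⟨-1, fun x hx hx0 => ?_⟩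
    by_contra hcon
    have hxpos : 0 < B x x :=
      lt_of_le_of_ne (by linarith) fun h => hx0 (hY x hx h.symm)
    obtain ⟨t, ht⟩ := exists_quadratic_eq_zero (a := B y y) (b := B x y + B y x) (c := B x x)
      hneg.ne ⟨√(discrim (B y y) (B x y + B y x) (B x x)), by
        rw [Real.mul_self_sqrt]
        rw [discrim]
        nlinarith [sq_nonneg (B x y + B y x), mul_pos hxpos (neg_pos.2 hneg)]⟩
    rw [← apply_self_add_smul] at ht
    have h0 := hY _ (Y.add_mem hx (Y.smul_mem t hy)) ht
    have hxy : x = -(t • y) := eq_neg_of_add_eq_zero_left h0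
    have : B x x = t * t * B y y := by
      rw [hxy]
      simp only [map_neg, map_smul, neg_apply, smul_apply, smul_eq_mul]
      ring
    nlinarith [mul_self_nonneg t]

/-- The kernel is complemented: pull `B` back along a projection onto it and add the Euclidean
square of `f`, which is positive off the kernel. -/
theorem exists_posDef_of_pos_on_ker {G : Type*} [NormedAddCommGroup G] [NormedSpace ℝ G]
    [FiniteDimensional ℝ G] (B : E →L[ℝ] E →L[ℝ] ℝ) (f : E →L[ℝ] G)
    (hB : ∀ y ∈ LinearMap.ker f.toLinearMap, y ≠ 0 → 0 < B y y) :
    ∃ Q : E →L[ℝ] E →L[ℝ] ℝ, ∀ x ≠ 0, 0 < Q x x := by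
  obtain ⟨π, hπ⟩ := f.ker_closedComplemented_of_finiteDimensional_range
  let p : E →L[ℝ] E := (Submodule.subtypeL _).comp π
  let g : E →L[ℝ] EuclideanSpace ℝ (Fin (Module.finrank ℝ G)) :=
    (toEuclidean : G ≃L[ℝ] _).toContinuousLinearMap.comp f
  refine ⟨B.bilinearComp p p + ((isBoundedBilinearMap_inner (𝕜 := ℝ)).toContinuousLinearMap).bilinearComp g g, fun x hx => ?_⟩
  have hQ : (B.bilinearComp p p + ((isBoundedBilinearMap_inner (𝕜 := ℝ)).toContinuousLinearMap).bilinearComp g g) x x =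
      B (p x) (p x) + ‖g x‖ ^ 2 := by
    rw [← real_inner_self_eq_norm_sq]
    rfl
  rw [hQ]
  by_cases hfx : f x = 0
  · have hpx : p x = x := congrArg Subtype.val (hπ ⟨x, hfx⟩)
    rw [hpx]
    have := hB x hfx hx
    positivity
  · have hg : g x ≠ 0 := fun h => hfx ((toEuclidean : G ≃L[ℝ] _).map_eq_zero_iff.1 h)
    have h1 : 0 ≤ B (p x) (p x) := by
      by_cases hp : p x = 0
      · simp [hp]
      · exact (hB (p x) (π x).2 hp).le
    have h2 : 0 < ‖g x‖ := norm_pos_iff.2 hg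
    positivity

/-- Being killed by `π` and orthogonal to the range of `i` is the kernel of one continuous map into
a finite-dimensional space. -/
theorem exists_posDef_of_anisotropic_complement {G : Type*} [NormedAddCommGroup G]
    [NormedSpace ℝ G] [FiniteDimensional ℝ G] (B : E →L[ℝ] E →L[ℝ] ℝ) (i : G →L[ℝ] E)
    (π : E →L[ℝ] G)
    (h : ∀ y, π y = 0 → (∀ w, B y (i w) + B (i w) y = 0) → B y y = 0 → y = 0) :
    ∃ Q : E →L[ℝ] E →L[ℝ] ℝ, ∀ x ≠ 0, 0 < Q x x := by
  obtain ⟨D, hD⟩ : ∃ D : E →L[ℝ] (G →L[ℝ] ℝ), ∀ x w, D x w = B x (i w) + B (i w) x :=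
    ⟨((ContinuousLinearMap.compL ℝ G E ℝ).flip i).comp (B + B.flip), fun x w => by simp⟩
  have hker : ∀ y ∈ LinearMap.ker (π.prod D).toLinearMap, B y y = 0 → y = 0 := by
    intro y hy
    have hfy : (π y, D y) = 0 := hy
    obtain ⟨hπy, hDy⟩ := Prod.mk_eq_zero.1 hfy
    exact h y hπy fun w => by rw [← hD, hDy, zero_apply]
  obtain ⟨σ, hσ⟩ := exists_smul_pos_of_anisotropic B _ hker
  have : FiniteDimensional ℝ (G →L[ℝ] ℝ) :=
    (LinearMap.toContinuousLinearMap : (G →ₗ[ℝ] ℝ) ≃ₗ[ℝ] (G →L[ℝ] ℝ)).finiteDimensional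
  exact exists_posDef_of_pos_on_ker (σ • B) (π.prod D) hσ

theorem exists_infinite_isotropic_of_no_posDef
    (hno : ¬ ∃ Q : E →L[ℝ] E →L[ℝ] ℝ, ∀ x ≠ 0, 0 < Q x x) (B : E →L[ℝ] E →L[ℝ] ℝ) :
    ∃ W : Submodule ℝ E, ¬ FiniteDimensional ℝ W ∧ ∀ w ∈ W, B w w = 0 := by
  obtain ⟨W, hW, hmax⟩ := exists_maximal_isotropic B
  refine ⟨W, fun hfin => hno ?_, hW⟩
  obtain ⟨π, hπ⟩ := Submodule.ClosedComplemented.of_finiteDimensional (𝕜 := ℝ) W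
  refine exists_posDef_of_anisotropic_complement B W.subtypeL π fun y hπy hDy hyy => ?_
  -- An isotropic `y` orthogonal to `W` can be adjoined to `W`, so maximality puts `y` in `W`, where
  -- the projection `π` fixes it.
  have hle : W ⊔ ℝ ∙ y ≤ W := by
    refine hmax (fun v hv => ?_) le_sup_left
    obtain ⟨w, hw, z, hz, rfl⟩ := Submodule.mem_sup.1 hv
    obtain ⟨t, rfl⟩ := Submodule.mem_span_singleton.1 hz
    have h1 : B y w + B w y = 0 := hDy ⟨w, hw⟩
    rw [apply_self_add_smul, hyy, hW w hw, add_comm (B w y), h1]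
    simp
  have hyW : y ∈ W := hle (Submodule.mem_sup_right (Submodule.mem_span_singleton_self y))
  have := hπ ⟨y, hyW⟩
  rw [hπy] at this
  exact (congrArg Subtype.val this).symm

theorem IsHomogeneousPolynomial.exists_bilinear {P : E → ℝ}
    (hP : IsHomogeneousPolynomial ℝ 2 P) : ∃ B : E →L[ℝ] E →L[ℝ] ℝ, ∀ x, P x = B x x := by
  obtain ⟨A, hA⟩ := hP
  refine ⟨(continuousMultilinearCurryFin1 ℝ E ℝ).toContinuousLinearEquiv.toContinuousLinearMap.comp
    (ContinuousMultilinearMap.curryLeft (n := 1) A), fun x => ?_⟩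
  rw [hA]
  change _ = A _
  congr 1
  funext i
  fin_cases i <;> rfl

theorem isHomogeneousPolynomial_three_smul (B : E →L[ℝ] E →L[ℝ] ℝ) :
    IsHomogeneousPolynomial ℝ 3 fun x : E => B x x • x := by
  refine ⟨{ toFun := fun v => B (v 0) (v 1) • v 2, map_update_add' := ?_, map_update_smul' := ?_,
            cont := by fun_prop }, fun x => rfl⟩
  · intro h m i x y
    obtain rfl : h = instDecidableEqFin 3 := Subsingleton.elim _ _
    fin_cases i <;> simp [add_smul]
  · intro h m i c x
    obtain rfl : h = instDecidableEqFin 3 := Subsingleton.elim _ _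
    fin_cases i <;> simp [smul_smul, mul_comm]

end RealQuadratic

end SummingSets

namespace SummingSets

/-! ### The Dvoretzky–Rogers theorem -/

section DvoretzkyRogers

variable {E : Type*} [NormedAddCommGroup E] [NormedSpace ℝ E]

theorem det_half_add_starProjection {H : Type*} [NormedAddCommGroup H] [InnerProductSpace ℝ H]
    [FiniteDimensional ℝ H] (V : Submodule ℝ H) :
    LinearMap.det (((1 / 2 : ℝ) • ContinuousLinearMap.id ℝ H +
      (3 / 2 : ℝ) • V.starProjection : H →L[ℝ] H) : H →ₗ[ℝ] H) =
      2 ^ Module.finrank ℝ V * (1 / 2) ^ (Module.finrank ℝ H - Module.finrank ℝ V) := by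
  set e : H →ₗ[ℝ] H := (((1 / 2 : ℝ) • ContinuousLinearMap.id ℝ H +
      (3 / 2 : ℝ) • V.starProjection : H →L[ℝ] H) : H →ₗ[ℝ] H) with he
  have heq (x : H) : e x = (1 / 2 : ℝ) • x + (3 / 2 : ℝ) • V.starProjection x := rfl
  have hV : V ≤ V.comap e := fun x hx => by
    rw [Submodule.mem_comap, heq]
    exact V.add_mem (V.smul_mem _ hx) (V.smul_mem _ (Submodule.starProjection_apply_mem V x))
  rw [LinearMap.det_eq_det_mul_det V e hV]
  have h1 : e.restrict hV = (2 : ℝ) • LinearMap.id := by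
    ext x
    rw [LinearMap.restrict_apply]
    simp only [heq, Submodule.starProjection_eq_self_iff.2 x.2, LinearMap.smul_apply,
      LinearMap.id_apply, Submodule.coe_smul, ← add_smul]
    norm_num
  have h2 : V.mapQ V e hV = (1 / 2 : ℝ) • LinearMap.id := by
    refine LinearMap.ext fun q => ?_
    obtain ⟨x, rfl⟩ := Submodule.Quotient.mk_surjective V q
    rw [Submodule.mapQ_apply, heq, Submodule.Quotient.mk_add, Submodule.Quotient.mk_smul,
      (Submodule.Quotient.mk_eq_zero V).2
        (V.smul_mem _ (Submodule.starProjection_apply_mem V x)), add_zero]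
    rfl
  rw [h1, h2, LinearMap.det_smul, LinearMap.det_smul, LinearMap.det_id, LinearMap.det_id,
    mul_one, mul_one, Submodule.finrank_quotient]

theorem exists_contraction_max_det {H : Type*} [NormedAddCommGroup H] [NormedSpace ℝ H]
    [FiniteDimensional ℝ H] (J : H →L[ℝ] E) (hJ : Function.Injective J) :
    ∃ M : H →L[ℝ] H, ‖J.comp M‖ ≤ 1 ∧ 0 < |M.det| ∧
      ∀ T : H →L[ℝ] H, ‖J.comp T‖ ≤ 1 → |T.det| ≤ |M.det| := by
  obtain ⟨K, hK0, hK⟩ := J.toLinearMap.exists_antilipschitzWith (LinearMap.ker_eq_bot.2 hJ)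
  have hKn (x : H) : ‖x‖ ≤ K * ‖J x‖ := by
    simpa using hK.le_mul_dist x 0
  -- Injectivity of `J` makes this set bounded; a small multiple of the identity will show that the
  -- maximum is nonzero.
  have hcomp : IsCompact {T : H →L[ℝ] H | ‖J.comp T‖ ≤ 1} := by
    refine Metric.isCompact_of_isClosed_isBounded ?_ ?_
    · have hc : Continuous fun T : H →L[ℝ] H => ‖J.comp T‖ :=
        (continuous_const.clm_comp continuous_id).norm
      exact isClosed_le hc continuous_const
    · refine (Metric.isBounded_closedBall (x := (0 : H →L[ℝ] H)) (r := K)).subset fun T hT => ?_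
      rw [mem_closedBall_zero_iff]
      refine ContinuousLinearMap.opNorm_le_bound _ K.2 fun x => (hKn _).trans ?_
      refine mul_le_mul_of_nonneg_left ?_ K.2
      simpa using (J.comp T).le_of_opNorm_le hT x
  obtain ⟨M, hM, hmax⟩ := hcomp.exists_isMaxOn ⟨0, by simp⟩
    (ContinuousLinearMap.continuous_det.abs.continuousOn)
  refine ⟨M, hM, ?_, fun T hT => hmax hT⟩
  set δ : ℝ := (‖J‖ + 1)⁻¹ with hδ
  have hδ0 : 0 < δ := by positivity
  have hmem : ‖J.comp (δ • ContinuousLinearMap.id ℝ H)‖ ≤ 1 := by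
    rw [ContinuousLinearMap.comp_smul, ContinuousLinearMap.comp_id, norm_smul, Real.norm_eq_abs,
      abs_of_pos hδ0, hδ, inv_mul_le_one₀ (by positivity)]
    linarith
  refine lt_of_lt_of_le ?_ (hmax hmem)
  have hd : (δ • ContinuousLinearMap.id ℝ H).det = δ ^ Module.finrank ℝ H := by
    change LinearMap.det (δ • (LinearMap.id : H →ₗ[ℝ] H)) = _
    rw [LinearMap.det_smul, LinearMap.det_id, mul_one]
  change 0 < |(δ • ContinuousLinearMap.id ℝ H).det|
  rw [hd]
  positivity

/-- A John-type position: a contraction that is not small on any subspace of more than half the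
dimension. -/
theorem exists_contraction_large_on_subspaces {H : Type*} [NormedAddCommGroup H]
    [InnerProductSpace ℝ H] [FiniteDimensional ℝ H] (J : H →L[ℝ] E)
    (hJ : Function.Injective J) :
    ∃ u : H →L[ℝ] E, ‖u‖ ≤ 1 ∧ ∀ V : Submodule ℝ H,
      Module.finrank ℝ H < 2 * Module.finrank ℝ V → ∃ x ∈ V, ‖x‖ = 1 ∧ 1 / 4 ≤ ‖u x‖ := by
  obtain ⟨M, hM, hpos, hmax⟩ := exists_contraction_max_det J hJ
  refine ⟨J.comp M, hM, fun V hV => ?_⟩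
  by_contra! hcon
  have hsmall : ∀ x ∈ V, ‖J.comp M x‖ ≤ 1 / 4 * ‖x‖ := by
    intro x hx
    by_cases hx0 : x = 0
    · simp [hx0]
    · have hn : 0 < ‖x‖ := norm_pos_iff.2 hx0
      have := (hcon (‖x‖⁻¹ • x) (V.smul_mem _ hx) (by
        rw [norm_smul, norm_inv, norm_norm, inv_mul_cancel₀ hn.ne'])).le
      rwa [map_smul, norm_smul, norm_inv, norm_norm, inv_mul_le_iff₀ hn, mul_comm] at this
  -- `T` is `2` on `V` and `1/2` on `Vᗮ`. The norm stays at most `2 * (1/4) + 1/2 = 1`, while the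
  -- determinant grows because `V` has more than half the dimension.
  set T : H →L[ℝ] H := (1 / 2 : ℝ) • ContinuousLinearMap.id ℝ H + (3 / 2 : ℝ) • V.starProjection
    with hT
  have hTn : ‖J.comp (M.comp T)‖ ≤ 1 := by
    refine ContinuousLinearMap.opNorm_le_bound _ zero_le_one fun x => ?_
    have hx : T x = (2 : ℝ) • V.starProjection x + (1 / 2 : ℝ) • (x - V.starProjection x) := by
      change (1 / 2 : ℝ) • x + (3 / 2 : ℝ) • V.starProjection x = _
      module
    have h1 : ‖V.starProjection x‖ ≤ ‖x‖ := Submodule.norm_starProjection_apply_le V x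
    have h2 : ‖x - V.starProjection x‖ ≤ ‖x‖ := by
      rw [← Submodule.starProjection_orthogonal_val]
      exact Submodule.norm_starProjection_apply_le Vᗮ x
    have h3 := hsmall _ (Submodule.starProjection_apply_mem V x)
    have h4 := (J.comp M).le_of_opNorm_le hM (x - V.starProjection x)
    calc ‖J.comp (M.comp T) x‖ = ‖J.comp M (T x)‖ := rfl
      _ ≤ 2 * ‖J.comp M (V.starProjection x)‖ +
          1 / 2 * ‖J.comp M (x - V.starProjection x)‖ := by
        rw [hx, map_add, map_smul, map_smul]
        refine (norm_add_le _ _).trans (le_of_eq ?_)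
        rw [norm_smul, norm_smul]
        norm_num
      _ ≤ 1 * ‖x‖ := by linarith
  have hdet := hmax (M.comp T) hTn
  have hle := Submodule.finrank_le V
  have hT1 : 1 < T.det := by
    have e := det_half_add_starProjection V
    rw [ContinuousLinearMap.det, hT, e, one_div, inv_pow, ← div_eq_mul_inv, one_lt_div (by positivity)]
    exact pow_lt_pow_right₀ one_lt_two (by omega)
  have hmul : (M.comp T).det = M.det * T.det := LinearMap.det_comp _ _
  rw [hmul, abs_mul, abs_of_pos (zero_lt_one.trans hT1)] at hdet
  nlinarith

/-- Greedy choice: while fewer than half the dimension has been used, the orthogonal complement is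
still large enough for `hp`. -/
theorem exists_orthonormal_of_large_on_subspaces {H : Type*} [NormedAddCommGroup H]
    [InnerProductSpace ℝ H] [FiniteDimensional ℝ H] {p : H → Prop}
    (hp : ∀ V : Submodule ℝ H, Module.finrank ℝ H < 2 * Module.finrank ℝ V →
      ∃ x ∈ V, ‖x‖ = 1 ∧ p x) (m : ℕ) (hm : 2 * m ≤ Module.finrank ℝ H) :
    ∃ v : Fin m → H, Orthonormal ℝ v ∧ ∀ i, p (v i) := by
  induction m with
  | zero => exact ⟨Fin.elim0, ⟨fun i => i.elim0, fun i => i.elim0⟩, fun i => i.elim0⟩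
  | succ m ih =>
    obtain ⟨v, hv, hpv⟩ := ih (by omega)
    have hrank := Submodule.finrank_add_finrank_orthogonal (Submodule.span ℝ (Set.range v))
    have hspan : Module.finrank ℝ (Submodule.span ℝ (Set.range v)) ≤ m := by
      simpa [Set.finrank] using finrank_range_le_card (R := ℝ) v
    obtain ⟨x, hx, hx1, hpx⟩ := hp (Submodule.span ℝ (Set.range v))ᗮ (by omega)
    have horth (i : Fin m) : inner ℝ (v i) x = 0 :=
      (Submodule.mem_orthogonal _ _).1 hx _ (Submodule.subset_span ⟨i, rfl⟩)
    refine ⟨Fin.cons x v, ⟨fun i => ?_, fun i j hij => ?_⟩, fun i => ?_⟩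
    · exact Fin.cases (by simpa using hx1) (fun i => by simpa using hv.1 i) i
    · induction i using Fin.cases with
      | zero =>
        induction j using Fin.cases with
        | zero => exact absurd rfl hij
        | succ j => simpa [real_inner_comm] using horth j
      | succ i =>
        induction j using Fin.cases with
        | zero => simpa using horth i
        | succ j => simpa using hv.2 fun h => hij (congrArg _ h)
    · exact Fin.cases (by simpa using hpx) (fun i => by simpa using hpv i) i

/-- A form of the Dvoretzky–Rogers lemma. -/
theorem exists_upper_two_estimate (hE : ¬ FiniteDimensional ℝ E) (m : ℕ) :
    ∃ e : Fin m → E, (∀ i, 1 / 4 ≤ ‖e i‖) ∧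
      ∀ t : Fin m → ℝ, ‖∑ i, t i • e i‖ ^ 2 ≤ ∑ i, t i ^ 2 := by
  have hrank : ((2 * m : ℕ) : Cardinal) ≤ Module.rank ℝ E := by
    refine (Cardinal.natCast_le_aleph0).trans ?_
    rw [← not_lt]
    exact fun h => hE (Module.rank_lt_aleph0_iff.1 h)
  obtain ⟨b, hb⟩ := exists_linearIndependent_of_le_rank hrank
  let L : EuclideanSpace ℝ (Fin (2 * m)) →ₗ[ℝ] E :=
    (Fintype.linearCombination ℝ b).comp (WithLp.linearEquiv 2 ℝ (Fin (2 * m) → ℝ)).toLinearMap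
  have hL : Function.Injective L :=
    (linearIndependent_iff_injective_fintypeLinearCombination.1 hb).comp (LinearEquiv.injective _)
  obtain ⟨u, hu, huV⟩ := exists_contraction_large_on_subspaces L.toContinuousLinearMap hL
  obtain ⟨v, hv, hvn⟩ := exists_orthonormal_of_large_on_subspaces huV m (by simp)
  refine ⟨fun i => u (v i), hvn, fun t => ?_⟩
  have h1 : ∑ i, t i • u (v i) = u (∑ i, t i • v i) := by simp
  have h2 : ‖∑ i, t i • v i‖ ^ 2 = ∑ i, t i ^ 2 := by
    rw [← real_inner_self_eq_norm_sq, hv.inner_sum]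
    simp [sq]
  rw [h1, ← h2]
  gcongr
  simpa using u.le_of_opNorm_le hu (∑ i, t i • v i)

theorem exists_block (hE : ¬ FiniteDimensional ℝ E) (k : ℕ) :
    ∃ z : ℕ → E, ∃ m : ℕ, (∀ i, m ≤ i → z i = 0) ∧ 1 ≤ ∑ i ∈ Finset.range m, ‖z i‖ ∧
      ∀ φ : StrongDual ℝ E, ‖φ‖ ≤ 1 → ∑ i ∈ Finset.range m, ‖φ (z i)‖ ≤ (1 / 2) ^ k := by
  -- With vectors of norm at least `1/4` scaled by `4 / m`, the norms add up to at least `1`, while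
  -- the weak sum is at most `√(m * (4 / m) ^ 2) = 4 / √m = 2⁻ᵏ`.
  set m : ℕ := 16 * 4 ^ k with hm
  obtain ⟨e, he, het⟩ := exists_upper_two_estimate hE m
  have hm0 : (0 : ℝ) < m := by rw [hm]; positivity
  refine ⟨fun i => if h : i < m then (4 / m : ℝ) • e ⟨i, h⟩ else 0, m, fun i hi => ?_, ?_, ?_⟩
  · exact dif_neg (by omega)
  · rw [Finset.sum_range]
    have h1 : ∀ i : Fin m, (1 / m : ℝ) ≤
        ‖(if h : (i : ℕ) < m then (4 / m : ℝ) • e ⟨i, h⟩ else 0 : E)‖ := by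
      intro i
      rw [dif_pos i.2, norm_smul, Real.norm_eq_abs, abs_of_pos (by positivity)]
      calc (1 / m : ℝ) = 4 / m * (1 / 4) := by ring
        _ ≤ _ := mul_le_mul_of_nonneg_left (he _) (by positivity)
    refine le_trans (le_of_eq ?_) (Finset.sum_le_sum fun i _ => h1 i)
    rw [Finset.sum_const, Finset.card_univ, Fintype.card_fin, nsmul_eq_mul]
    field_simp
  · intro φ hφ
    rw [Finset.sum_range]
    have hsign : ∀ r : ℝ, ∃ s : ℝ, s ^ 2 = 1 ∧ s * r = ‖r‖ := by
      intro r
      rcases le_total 0 r with hr | hr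
      · exact ⟨1, by norm_num, by rw [one_mul, Real.norm_of_nonneg hr]⟩
      · exact ⟨-1, by norm_num, by rw [neg_one_mul, Real.norm_of_nonpos hr]⟩
    choose s hs hsr using hsign
    set t : Fin m → ℝ := fun i => s (φ (e i)) * (4 / m) with ht
    have h1 : ∑ i : Fin m, ‖φ (if h : (i : ℕ) < m then (4 / m : ℝ) • e ⟨i, h⟩ else 0 : E)‖ =
        φ (∑ i, t i • e i) := by
      rw [map_sum]
      refine Finset.sum_congr rfl fun i _ => ?_
      rw [dif_pos i.2, map_smul, map_smul, smul_eq_mul, smul_eq_mul, norm_mul, ← hsr (φ (e i)),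
        Real.norm_eq_abs, abs_of_pos (by positivity), ht]
      ring
    rw [h1]
    have h2 : φ (∑ i, t i • e i) ≤ ‖∑ i, t i • e i‖ :=
      (le_abs_self _).trans (by simpa using φ.le_of_opNorm_le hφ (∑ i, t i • e i))
    refine h2.trans (abs_le_of_sq_le_sq' ?_ (by positivity)).2
    refine (het t).trans (le_of_eq ?_)
    have h3 : ∀ i, t i ^ 2 = (4 / m : ℝ) ^ 2 := fun i => by rw [ht, mul_pow, hs, one_mul]
    rw [Finset.sum_congr rfl fun i _ => h3 i, Finset.sum_const, Finset.card_univ,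
      Fintype.card_fin, nsmul_eq_mul]
    have hmr : (m : ℝ) = 16 * (2 ^ k) ^ 2 := by
      rw [hm]
      push_cast
      rw [← pow_mul, mul_comm k 2, pow_mul]
      norm_num
    rw [hmr, one_div, inv_pow]
    have : (2 : ℝ) ^ k ≠ 0 := by positivity
    field_simp
    ring

/-- The Dvoretzky–Rogers theorem. -/
theorem exists_unconditionallySummable_not_summable_norm (hE : ¬ FiniteDimensional ℝ E) :
    ∃ x : ℕ → E, UnconditionallySummable ℝ 1 x ∧ ¬ Summable fun j => ‖x j‖ := by
  choose z m hz hz1 hzφ using exists_block hE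
  let x : ℕ → E := fun j => z j.unpair.1 j.unpair.2
  have hblock : ∀ φ : StrongDual ℝ E, ‖φ‖ ≤ 1 → ∀ k,
      ∑' i, ‖φ (z k i)‖ₑ ≤ ENNReal.ofReal ((1 / 2) ^ k) := by
    intro φ hφ k
    rw [tsum_eq_sum (s := Finset.range (m k)) fun i hi => by
      rw [hz k i (by simpa using hi)]; simp]
    simp only [← ofReal_norm]
    rw [← ENNReal.ofReal_sum_of_nonneg fun _ _ => norm_nonneg _]
    exact ENNReal.ofReal_le_ofReal (hzφ k φ hφ)
  have hgeom : ∑' k : ℕ, ENNReal.ofReal ((1 / 2 : ℝ) ^ k) ≠ ∞ := by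
    rw [← ENNReal.ofReal_tsum_of_nonneg (fun _ => by positivity) summable_geometric_two]
    exact ENNReal.ofReal_ne_top
  have htail : ∀ K : ℕ, ∃ N : ℕ, ∀ n, N ≤ n → weakNorm ℝ 1 (fun j => x (n + j)) ≤
      ∑' k : ℕ, ENNReal.ofReal ((1 / 2 : ℝ) ^ (k + K)) := by
    intro K
    -- The first `K` blocks have finitely many nonzero entries, so far tails see only later blocks,
    -- with geometrically small weak sums.
    obtain ⟨N, hN⟩ : ∃ N : ℕ, ∀ j, N ≤ j → j.unpair.1 < K → x j = 0 := by
      refine ⟨(Finset.range K).sup fun k => (Finset.range (m k)).sup fun i => Nat.pair k i + 1,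
        fun j hj hjK => ?_⟩
      refine hz _ _ (not_lt.1 fun hlt => ?_)
      have h1 := Finset.le_sup (f := fun i => Nat.pair j.unpair.1 i + 1) (Finset.mem_range.2 hlt)
      have h2 := Finset.le_sup
        (f := fun k => (Finset.range (m k)).sup fun i => Nat.pair k i + 1)
        (Finset.mem_range.2 hjK)
      have h3 := (h1.trans h2).trans hj
      rw [Nat.pair_unpair] at h3
      omega
    refine ⟨N, fun n hn => ?_⟩
    rw [weakNorm_one]
    refine iSup₂_le fun φ hφ => ?_
    let y : ℕ × ℕ → ℝ≥0∞ := fun q => if q.1 < K then 0 else ‖φ (z q.1 q.2)‖ₑ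
    calc ∑' j, ‖φ (x (n + j))‖ₑ = ∑' j, y (Nat.unpair (n + j)) := by
          refine tsum_congr fun j => ?_
          by_cases h : (Nat.unpair (n + j)).1 < K
          · rw [hN _ (by omega) h]
            simp [y, h]
          · simp [y, h, x]
      _ ≤ ∑' j, y (Nat.unpair j) :=
          ENNReal.tsum_comp_le_tsum_of_injective (add_right_injective n) _
      _ = ∑' q, y q := Nat.pairEquiv.symm.tsum_eq y
      _ = ∑' k, ∑' i, y (k, i) := ENNReal.tsum_prod (f := fun k i => y (k, i))
      _ = ∑' k, ∑' i, y (k + K, i) := by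
          rw [← (ENNReal.summable (f := fun k => ∑' i, y (k + K, i))).sum_add_tsum_nat_add'
            (f := fun k => ∑' i, y (k, i))]
          rw [Finset.sum_eq_zero fun k hk => by simp [y, Finset.mem_range.1 hk], zero_add]
      _ ≤ _ := ENNReal.tsum_le_tsum fun k => by simpa [y] using hblock φ hφ (k + K)
  refine ⟨x, ⟨fun φ => ?_, ?_⟩, fun hsum => ?_⟩
  · obtain ⟨N, hN⟩ := htail 0
    rw [memℓp_one_iff_summable, ← summable_nat_add_iff N]
    set c : ℝ := ‖φ‖ + 1 with hc
    have hc0 : 0 < c := by positivity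
    have hψ : ‖c⁻¹ • φ‖ ≤ 1 := by
      rw [norm_smul, norm_inv, Real.norm_of_nonneg hc0.le, inv_mul_le_one₀ hc0]
      linarith
    have h1 : ∑' j, ‖(c⁻¹ • φ) (x (N + j))‖ₑ ≠ ∞ :=
      ne_top_of_le_ne_top hgeom
        ((tsum_enorm_le_weakNorm_one (fun j => x (N + j)) hψ).trans (by simpa using hN N le_rfl))
    have h2 : Summable fun j => ‖(c⁻¹ • φ) (x (N + j))‖ := by
      simpa using ENNReal.summable_toReal h1
    refine (h2.mul_left c).congr fun j => ?_
    rw [smul_apply, norm_smul, norm_inv, Real.norm_of_nonneg hc0.le, mul_inv_cancel_left₀ hc0.ne',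
      add_comm]
  · have hlim : Tendsto (fun K => ∑' k : ℕ, ENNReal.ofReal ((1 / 2 : ℝ) ^ (k + K))) atTop (𝓝 0) :=
      ENNReal.tendsto_sum_nat_add _ hgeom
    rw [ENNReal.tendsto_nhds_zero] at hlim ⊢
    intro ε hε
    obtain ⟨K, hK⟩ := (hlim ε hε).exists
    obtain ⟨N, hN⟩ := htail K
    filter_upwards [eventually_ge_atTop N] with n hn using (hN n hn).trans hK
  · have h1 : Summable fun q : ℕ × ℕ => ‖z q.1 q.2‖ :=
      Nat.pairEquiv.symm.summable_iff.1 hsum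
    -- Summable norms would make the block sums tend to `0`, yet each is at least `1`.
    have h2 : Tendsto (fun k => ∑' i, ‖z k i‖) atTop (𝓝 0) := h1.prod.tendsto_atTop_zero
    obtain ⟨k, hk⟩ := (h2.eventually (gt_mem_nhds zero_lt_one)).exists
    rw [tsum_eq_sum (s := Finset.range (m k)) fun i hi => by
      rw [hz k i (by simpa using hi)]; simp] at hk
    exact absurd (hz1 k) (not_le.2 hk)

end DvoretzkyRogers

end SummingSets

namespace SummingSets

/-! ### The cubic map of a positive definite form -/

section Cubic

variable {E : Type*} [NormedAddCommGroup E] [NormedSpace ℝ E]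

theorem summingSetOne_apply_self_smul (hE : ¬ FiniteDimensional ℝ E) (B : E →L[ℝ] E →L[ℝ] ℝ)
    (hB : ∀ x ≠ 0, 0 < B x x) : summingSetOne ℝ (fun x : E => B x x • x) = {0} := by
  have hpoly : IsHomogeneousPolynomial ℝ 2 fun x : E => B x x := by
    refine ⟨{ toFun := fun v => B (v 0) (v 1), map_update_add' := ?_, map_update_smul' := ?_,
              cont := by fun_prop }, fun x => rfl⟩
    · intro h m i x y
      obtain rfl : h = instDecidableEqFin 2 := Subsingleton.elim _ _
      fin_cases i <;> simp
    · intro h m i c x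
      obtain rfl : h = instDecidableEqFin 2 := Subsingleton.elim _ _
      fin_cases i <;> simp
  refine Set.Subset.antisymm (fun a ha => ?_) ?_
  · by_contra ha0
    obtain ⟨x, hx, hnot⟩ := exists_unconditionallySummable_not_summable_norm hE
    have hpos := hB a ha0
    have h1 := memℓp_one_iff_summable.1 (ha x hx)
    obtain ⟨M, hM⟩ := (hx.tendsto_zero.const_add a).norm.bddAbove_range
    have h2 := (hpoly.summable_increments a hx).mul_right M
    refine hnot (((h1.add h2).mul_left (B a a)⁻¹).of_nonneg_of_le (fun _ => norm_nonneg _)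
      fun j => ?_)
    -- The first difference is summable by assumption on `a`, the second because scalar polynomials
    -- are summing everywhere; so `‖x j‖` would be summable.
    have h3 : B a a • x j = (B (a + x j) (a + x j) • (a + x j) - B a a • a) -
        (B (a + x j) (a + x j) - B a a) • (a + x j) := by
      module
    have h4 : B a a * ‖x j‖ = ‖B a a • x j‖ := by
      rw [norm_smul, Real.norm_of_nonneg hpos.le]
    rw [← div_eq_inv_mul, le_div_iff₀ hpos, mul_comm, h4, h3]
    refine (norm_sub_le _ _).trans (add_le_add le_rfl ?_)
    rw [norm_smul]
    exact mul_le_mul_of_nonneg_left (hM ⟨j, rfl⟩) (norm_nonneg _)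
  · rintro _ rfl
    exact mem_summingSetOne_of_eq_zero hpoly continuous_id (by simp)

end Cubic

end SummingSets

theorem mainTheorem9 :
    -- complex case
    (∀ (E : Type*) [NormedAddCommGroup E] [NormedSpace ℂ E] [CompleteSpace E]
       (F : Type*) [NormedAddCommGroup F] [NormedSpace ℂ F] [CompleteSpace F],
       ¬ FiniteDimensional ℂ E →
       ∀ n : ℕ, 1 ≤ n →
       ∀ P : E → ℂ, SummingSets.IsHomogeneousPolynomial ℂ n P →
       ∀ g : E → F, Continuous g →
         SummingSets.Spaceable ℂ (SummingSets.summingSetOne ℂ (fun x => P x • g x))) ∧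
    -- real case
    (∀ (E : Type*) [NormedAddCommGroup E] [NormedSpace ℝ E] [CompleteSpace E]
       (F : Type*) [NormedAddCommGroup F] [NormedSpace ℝ F] [CompleteSpace F],
       ¬ FiniteDimensional ℝ E →
       (∃ P : E → E, SummingSets.IsHomogeneousPolynomial ℝ 3 P ∧
          SummingSets.summingSetOne ℝ P = {0}) ∨
       (∀ P : E → ℝ, SummingSets.IsHomogeneousPolynomial ℝ 2 P →
        ∀ g : E → F, Continuous g →
          SummingSets.Spaceable ℝ (SummingSets.summingSetOne ℝ (fun x => P x • g x)))) := by
  refine ⟨fun E _ _ _ F _ _ _ hE n hn P hP g hg => ?_, fun E _ _ _ F _ _ _ hE => ?_⟩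
  · obtain ⟨W, hW, hPW⟩ := hP.exists_infinite_vanishing_complex hE hn
    exact SummingSets.spaceable_summingSetOne_of_vanishing hP hg hW hPW
  · by_cases hpos : ∃ Q : E →L[ℝ] E →L[ℝ] ℝ, ∀ x ≠ 0, 0 < Q x x
    · obtain ⟨Q, hQ⟩ := hpos
      exact Or.inl ⟨_, SummingSets.isHomogeneousPolynomial_three_smul Q,
        SummingSets.summingSetOne_apply_self_smul hE Q hQ⟩
    · refine Or.inr fun P hP g hg => ?_
      obtain ⟨B, hB⟩ := hP.exists_bilinear
      obtain ⟨W, hW, hBW⟩ := SummingSets.exists_infinite_isotropic_of_no_posDef hpos B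
      exact SummingSets.spaceable_summingSetOne_of_vanishing hP hg hW
        fun w hw => (hB w).trans (hBW w hw)
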